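/- **Economy.** Let $(\Omega,\mathscr F,\mathbb P)$ be a complete probability space (states of nature) and $(T,\Sigma,\mu)$ a complete finite measure space (agents). Write $T=T_0\cup T_1$, where $T_1=\bigcup\mathscr A$ is the union of a countable family $\mathscr A$ of pairwise disjoint $\mu$-atoms (the large agents) and $T_0=T\setminus T_1$ contains no $\mu$-atom. Each agent $t\in T$ has consumption set $\mathbb R^\ell_+$ and is characterized by a partition $\Pi_t$ of $\Omega$ into $\mathscr F$-measurable cells, generating the $\sigma$-algebra $\mathscr F_t$; a utility function $U(t,\cdot,\cdot):\Omega\times\mathbb R^\ell_+\to\mathbb R$; an endowment $a(t,\cdot):\Omega\to\mathbb R^\ell_+$; and a probability measure $\mathbb P_t$ on $\mathscr F$. There are partitions $\mathscr Q_1,\dots,\mathscr Q_n$ of $\Omega$ such that every $\Pi_t$ is one of them. For $S\in\Sigma$ put $S^i=\{t\in S:\Pi_t=\mathscr Q_i\}$ and $\mathfrak P(S)=\{i:\mu(S^i)>0\}$ (the sets $T^i$ are assumed measurable), and let $\bigvee\{\mathscr Q_i:i\in I\}$ be the $\sigma$-algebra generated by the common refinement of the $\mathscr Q_i$, $i\in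 I$. For $x,y\in\mathbb R^\ell$, $x\gg y$ means $x_k>y_k$ for all $k$. **Assumptions.** * (A$'_1$) $a$ is $\Sigma\otimes\mathscr F$-measurable, and for each $\omega$, $a(\cdot,\omega)$ is Bochner integrable and $a(\cdot,\omega)\gg0$ $\mu$-a.e. on $T$. * (A$_2$) $U(\cdot,\cdot,x)$ is $\Sigma\otimes\mathscr F$-measurable for every $x\in\mathbb R^\ell_+$. * (A$_3$) $U(t,\omega,\cdot)$ is continuous and strictly increasing (if $x\le y$ and $x\neq y$ then $U(t,\omega,x)<U(t,\omega,y)$) for all $(t,\omega)\in T\times\Omega$. * (A$'_4$) $U(t,\omega,\cdot)$ is quasi-concave for all $(t,\omega)\in T_1\times\Omega$. * (A$_5$) $\mu(T^i)>0$ for all $1\le i\le n$, $T=\bigcup_{i=1}^n T^i$, and $\bigvee_{i=1}^n\mathscr Q_i=\mathscr F$. * (A$_6$) All $t\in T_1$ have the same characteristics $(\Pi_t,U(t,\cdot,\cdot),a(t,\cdot),\mathbb P_t)$. **Fine core.** An *assignment* is a function $f:T\times\Omega\to\mathbb R^\ell_+$ such that $f(\cdot,\omega)$ is Bochner integrable for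 every $\omega$ and $f(t,\cdot)$ is $\mathscr F$-measurable for every $t$; it is an *allocation* if $\int_T f(\cdot,\omega)\,d\mu=\int_T a(\cdot,\omega)\,d\mu$ for every $\omega$. A *coalition* is a set $S\in\Sigma$ with $\mu(S)>0$. A *communication system* for $S$ is a family $\{\mathscr G_t:t\in S\}$ of sub-$\sigma$-algebras of $\mathscr F$ such that $\{t\in S:\mathscr G_t=\mathscr G\}\in\Sigma$ for every $\sigma$-algebra $\mathscr G\subseteq\mathscr F$, and $\mathscr F_t\subseteq\mathscr G_t\subseteq\bigvee\{\mathscr Q_i:i\in\mathfrak P(S)\}$ for $\mu$-a.e. $t\in S$. An allocation $f$ is *fine blocked* by $S$ if there are an allocation $g$, a communication system $\{\mathscr G_t:t\in S\}$ for $S$ and a nonempty event $\Omega_0\in\bigcap_{t\in S}\mathscr G_t$ such that for all $\omega\in\Omega_0$ $$\int_S g(\cdot,\omega)\,d\mu=\int_S a(\cdot,\omega)\,d\mu$$ and, for $\mu$-a.e. $t\in S$, $$\mathbb E_t[U(t,\cdot,g(t,\cdot))\mid\mathscr G_t](\omega)>\mathbb E_t[U(t,\cdot,f(t,\cdot))\mid\mathscr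 G_t](\omega).$$ Here $\mathbb E_t$ is expectation under $\mathbb P_t$; both utilities are required to be $\mathbb P_t$-integrable on $\Omega_0$, and the conditional expectations are those of the utilities multiplied by $1_{\Omega_0}$, which amounts to the same on $\Omega_0$; the inequality is required for all versions of the conditional expectations, with the convention that $\mathbb E_t[u\mid\mathscr G]$ is $u$ itself if $u$ is $\mathscr G$-measurable. The *fine core* $\mathbf C^{fine}(\mathscr E)$ is the set of allocations that are not fine blocked by any coalition. **Theorem 4.1.** Assume (A$'_1$), (A$_2$), (A$_3$), (A$'_4$), (A$_5$), (A$_6$) and $\mathscr A\ne\emptyset$. Let $f\in\mathbf C^{fine}(\mathscr E)$ and put $\bar f(t,\omega)=f(t,\omega)$ for $t\in T_0$ and $\bar f(t,\omega)=\frac1{\mu(T_1)}\int_{T_1}f(\cdot,\omega)\,d\mu$ for $t\in T_1$. Then for every $\omega\in\Omega$, $$U(t,\omega,\bar f(t,\omega))=U(t,\omega,f(t,\omega))\qquad\text{for }\mu\text{-a.e. }t\in T.$$ -/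

import Mathlib

open MeasureTheory

/-- The consumption set, the nonnegative orthant of `ℝ^ℓ`
(`Fin ℓ → ℝ` carries the coordinatewise order). -/
def orthant (ℓ : ℕ) : Set (Fin ℓ → ℝ) := {x | 0 ≤ x}

/-- `A` is an atom of the measure `μ`. -/
def IsMeasureAtom {T : Type*} [MeasurableSpace T] (μ : Measure T) (A : Set T) : Prop :=
  MeasurableSet A ∧ 0 < μ A ∧
    ∀ B ⊆ A, MeasurableSet B → μ B = 0 ∨ μ (A \ B) = 0

/-- The `σ`-algebra generated by a partition. A partition of `Ω` is given by the equivalence relation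
whose classes are its cells; the common refinement of partitions is then the infimum. -/
abbrev partitionAlgebra {Ω : Type*} (r : Setoid Ω) : MeasurableSpace Ω :=
  MeasurableSpace.generateFrom r.classes

/-- A pure exchange mixed economy with asymmetric information and `ℓ` commodities. -/
structure Economy (Ω T : Type*) [MeasurableSpace Ω] [MeasurableSpace T] (ℓ : ℕ) where
  /-- the complete probability measure on the states of nature -/
  prob : Measure Ω
  isProbabilityMeasure_prob : IsProbabilityMeasure prob
  isComplete_prob : prob.IsComplete
  /-- the complete finite measure on the space of agents -/
  μ : Measure T
  isFiniteMeasure_μ : IsFiniteMeasure μ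
  isComplete_μ : μ.IsComplete
  /-- the countable family of the atoms of `μ`, that is, of the large agents -/
  atoms : Set (Set T)
  countable_atoms : atoms.Countable
  isMeasureAtom_of_mem : ∀ A ∈ atoms, IsMeasureAtom μ A
  pairwiseDisjoint_atoms : atoms.PairwiseDisjoint id
  /-- the rest of the space of agents is atomless -/
  atomless_compl : ∀ B ⊆ (⋃₀ atoms)ᶜ, ¬ IsMeasureAtom μ B
  /-- the information partition of each agent -/
  part : T → Setoid Ω
  measurableSet_cell : ∀ t, ∀ C ∈ (part t).classes, MeasurableSet C
  /-- the state-dependent utility functions; only their values on the orthant are ever used -/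
  U : T → Ω → (Fin ℓ → ℝ) → ℝ
  /-- the state-dependent initial endowments -/
  a : T → Ω → (Fin ℓ → ℝ)
  a_mem : ∀ t ω, a t ω ∈ orthant ℓ
  /-- the prior beliefs -/
  P : T → Measure Ω
  isProbabilityMeasure_P : ∀ t, IsProbabilityMeasure (P t)

/-- `φ` is a version of the conditional expectation `E[u | G]` under `P` of an integrable `u`,
with the convention that `E[u | G]` is `u` itself when `u` is `G`-measurable. -/
structure IsCondExpVersion {Ω : Type*} [MeasurableSpace Ω] (P : Measure Ω)
    (G : MeasurableSpace Ω) (u φ : Ω → ℝ) : Prop where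
  measurable : Measurable[G] φ
  ae_eq : φ =ᵐ[P] P[u | G]
  eq_self : Measurable[G] u → φ = u

namespace Economy

variable {Ω T : Type*} [mΩ : MeasurableSpace Ω] [MeasurableSpace T] {ℓ : ℕ}

/-- The set `T₁` of large agents: the union of the atoms. -/
def T₁ (E : Economy Ω T ℓ) : Set T := ⋃₀ E.atoms

/-- The private information `F_t` of agent `t`. -/
abbrev info (E : Economy Ω T ℓ) (t : T) : MeasurableSpace Ω := partitionAlgebra (E.part t)

/-- Endowments are jointly measurable, integrable over the agents and strictly positive in every
commodity for almost every agent. -/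
def A1' (E : Economy Ω T ℓ) : Prop :=
  Measurable (fun p : T × Ω => E.a p.1 p.2) ∧
    (∀ ω, Integrable (fun t => E.a t ω) E.μ) ∧
    ∀ ω, ∀ᵐ t ∂E.μ, ∀ k, 0 < E.a t ω k

/-- Utilities are jointly measurable in agent and state. -/
def A2 (E : Economy Ω T ℓ) : Prop :=
  ∀ x ∈ orthant ℓ, Measurable (fun p : T × Ω => E.U p.1 p.2 x)

/-- Utilities are continuous and strictly increasing in consumption. -/
def A3 (E : Economy Ω T ℓ) : Prop :=
  ∀ t ω, ContinuousOn (E.U t ω) (orthant ℓ) ∧ StrictMonoOn (E.U t ω) (orthant ℓ)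

/-- Utilities of large agents are quasi-concave. -/
def A4' (E : Economy Ω T ℓ) : Prop :=
  ∀ t ∈ E.T₁, ∀ ω, QuasiconcaveOn ℝ (orthant ℓ) (E.U t ω)

/-- `S^i`: the agents in `S` whose information partition is `Q i`. -/
def typeSet (E : Economy Ω T ℓ) {n : ℕ} (Q : Fin n → Setoid Ω) (S : Set T) (i : Fin n) : Set T :=
  {t ∈ S | E.part t = Q i}

/-- The indices of the information partitions that a non-null set of agents in `S` has. -/
def types (E : Economy Ω T ℓ) {n : ℕ} (Q : Fin n → Setoid Ω) (S : Set T) : Set (Fin n) :=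
  {i | 0 < E.μ (E.typeSet Q S i)}

/-- The joint information of `S`: the `σ`-algebra generated by the common refinement of the
information partitions present in `S`. -/
abbrev jointInfo (E : Economy Ω T ℓ) {n : ℕ} (Q : Fin n → Setoid Ω) (S : Set T) :
    MeasurableSpace Ω :=
  partitionAlgebra (⨅ i ∈ E.types Q S, Q i)

/-- Every agent has one of the information partitions `Q i`, each of them is held by a (measurable)
non-null set of agents, and together they generate the `σ`-algebra of all events. -/
def A5 (E : Economy Ω T ℓ) {n : ℕ} (Q : Fin n → Setoid Ω) : Prop :=
  (∀ i, MeasurableSet (E.typeSet Q Set.univ i)) ∧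
    (∀ i, 0 < E.μ (E.typeSet Q Set.univ i)) ∧
    (⋃ i, E.typeSet Q Set.univ i) = Set.univ ∧
    partitionAlgebra (⨅ i, Q i) = mΩ

/-- All large agents have the same characteristics. -/
def A6 (E : Economy Ω T ℓ) : Prop :=
  ∀ t ∈ E.T₁, ∀ s ∈ E.T₁,
    E.part t = E.part s ∧ (∀ ω, Set.EqOn (E.U t ω) (E.U s ω) (orthant ℓ)) ∧
      E.a t = E.a s ∧ E.P t = E.P s

/-- Assignments of bundles to agents and states. -/
structure IsAssignment (E : Economy Ω T ℓ) (f : T → Ω → (Fin ℓ → ℝ)) : Prop where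
  mem : ∀ t ω, f t ω ∈ orthant ℓ
  integrable : ∀ ω, Integrable (fun t => f t ω) E.μ
  measurable : ∀ t, Measurable (f t)

/-- Allocations: feasible assignments. -/
structure IsAllocation (E : Economy Ω T ℓ) (f : T → Ω → (Fin ℓ → ℝ)) : Prop
    extends E.IsAssignment f where
  feasible : ∀ ω, ∫ t, f t ω ∂E.μ = ∫ t, E.a t ω ∂E.μ

/-- Coalitions: measurable sets of agents of positive measure. -/
def IsCoalition (E : Economy Ω T ℓ) (S : Set T) : Prop := MeasurableSet S ∧ 0 < E.μ S

/-- Information structures `(G t)` for `S`; the values of `G` outside `S` are irrelevant. -/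
structure IsInformationStructure (_E : Economy Ω T ℓ) (S : Set T) (G : T → MeasurableSpace Ω) :
    Prop where
  le : ∀ t ∈ S, G t ≤ mΩ
  measurableSet_eq : ∀ H : MeasurableSpace Ω, H ≤ mΩ → MeasurableSet {t ∈ S | G t = H}

/-- Communication systems for `S`. -/
structure IsCommunicationSystem (E : Economy Ω T ℓ) {n : ℕ} (Q : Fin n → Setoid Ω) (S : Set T)
    (G : T → MeasurableSpace Ω) : Prop extends E.IsInformationStructure S G where
  info_le : ∀ᵐ t ∂E.μ, t ∈ S → E.info t ≤ G t ∧ G t ≤ E.jointInfo Q S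

/-- On the event `Ω₀` (which belongs to `G t`) agent `t` has integrable utility from the plans `x` and
`y`, and at `ω ∈ Ω₀` the conditional expectation given `G t` of the utility from `y` exceeds the one
from `x`. As `Ω₀` belongs to `G t`, on `Ω₀` the conditional expectation of a random variable is the one
of its restriction to `Ω₀`, so no integrability outside `Ω₀` is needed. Conditional expectations are
determined only up to null sets; the inequality is demanded for all versions. -/
def InterimPrefers (E : Economy Ω T ℓ) (t : T) (G : T → MeasurableSpace Ω) (Ω₀ : Set Ω)
    (x y : Ω → (Fin ℓ → ℝ)) (ω : Ω) : Prop :=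
  IntegrableOn (fun ω' => E.U t ω' (x ω')) Ω₀ (E.P t) ∧
    IntegrableOn (fun ω' => E.U t ω' (y ω')) Ω₀ (E.P t) ∧
    ∀ φ ψ : Ω → ℝ,
      IsCondExpVersion (E.P t) (G t) (Ω₀.indicator fun ω' => E.U t ω' (x ω')) φ →
      IsCondExpVersion (E.P t) (G t) (Ω₀.indicator fun ω' => E.U t ω' (y ω')) ψ →
      φ ω < ψ ω

/-- `f` is fine blocked by the coalition `S`. -/
def IsFineBlockedBy (E : Economy Ω T ℓ) {n : ℕ} (Q : Fin n → Setoid Ω)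
    (f : T → Ω → (Fin ℓ → ℝ)) (S : Set T) : Prop :=
  ∃ (g : T → Ω → (Fin ℓ → ℝ)) (G : T → MeasurableSpace Ω) (Ω₀ : Set Ω),
    E.IsAllocation g ∧ E.IsCommunicationSystem Q S G ∧
    Ω₀.Nonempty ∧ (∀ t ∈ S, MeasurableSet[G t] Ω₀) ∧
    ∀ ω ∈ Ω₀, ∫ t in S, g t ω ∂E.μ = ∫ t in S, E.a t ω ∂E.μ ∧
      ∀ᵐ t ∂E.μ, t ∈ S → E.InterimPrefers t G Ω₀ (f t) (g t) ω

/-- The fine core. -/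
def fineCore (E : Economy Ω T ℓ) {n : ℕ} (Q : Fin n → Setoid Ω) :
    Set (T → Ω → (Fin ℓ → ℝ)) :=
  {f | E.IsAllocation f ∧ ∀ S, E.IsCoalition S → ¬ E.IsFineBlockedBy Q f S}

open Classical in
/-- `f̄`: in `f`, the bundles of the large agents are replaced by their average. -/
noncomputable def average (E : Economy Ω T ℓ) (f : T → Ω → (Fin ℓ → ℝ)) :
    T → Ω → (Fin ℓ → ℝ) := fun t ω =>
  if t ∈ E.T₁ then (E.μ.real E.T₁)⁻¹ • ∫ s in E.T₁, f s ω ∂E.μ else f t ω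

end Economy

/-! Fix `ω`. The partitions jointly generate all events, so the cell of `ω` in their common
refinement is an event on which endowments, plans and utilities of fixed bundles do not vary. A
coalition containing every information type can pool its information, so an improvement in the state
`ω` alone is enough for fine blocking (`isFineBlockedBy_of_state`). What remains is a deterministic
mixed economy.

There, let `u` be the common utility of the large agents and `b` their average bundle. If `u (f t ω)
≤ c < u b` on a non-null set `D` of them, then `D` blocks together with a sample of small agents
whose net trade is nearly proportional to that of all small agents: the sample keeps `f`, and each
member of `D` is left with nearly `b`. Positive endowments give room for the approximation error
(`exists_isFineBlockedBy_of_lt_average`).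

So almost every large agent gets at least `u b`. A non-null set of them cannot get more: shrinking
the better bundles slightly would give an average strictly below `b`, yet by quasi-concavity at
least as good, against monotonicity (`ae_eq_of_average_le`). -/

/-! ### Atomless measures: Sierpiński's theorem and approximate Lyapunov convexity. -/

section Atomless

variable {T : Type*} [MeasurableSpace T] {μ : Measure T}

/-- In an atomless measure space, a non-null set contains a non-null set of at most half its
measure. -/
theorem exists_subset_measureReal_le_half [IsFiniteMeasure μ] (hμ : ∀ B, ¬ IsMeasureAtom μ B)
    {A : Set T} (hA : MeasurableSet A) (hA0 : 0 < μ.real A) :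
    ∃ B ⊆ A, MeasurableSet B ∧ 0 < μ.real B ∧ μ.real B ≤ μ.real A / 2 := by
  have hA0' : 0 < μ A := (ENNReal.toReal_pos_iff.1 hA0).1
  have h := hμ A
  simp only [IsMeasureAtom, hA, hA0', true_and, not_forall, not_or] at h
  obtain ⟨B, hBA, hB, hB0, hB1⟩ := h
  have pos : ∀ {C : Set T}, μ C ≠ 0 → 0 < μ.real C := fun h =>
    ENNReal.toReal_pos h (measure_ne_top _ _)
  have hsum : μ.real (A \ B) = μ.real A - μ.real B := measureReal_sdiff hBA hB
  rcases le_total (μ.real B) (μ.real A / 2) with h | h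
  · exact ⟨B, hBA, hB, pos hB0, h⟩
  · exact ⟨A \ B, Set.sdiff_subset, hA.diff hB, pos hB1, by linarith⟩

/-- In an atomless measure space, a non-null set contains non-null sets of arbitrarily small
measure. -/
theorem exists_subset_measureReal_le [IsFiniteMeasure μ] (hμ : ∀ B, ¬ IsMeasureAtom μ B)
    {A : Set T} (hA : MeasurableSet A) (hA0 : 0 < μ.real A) {ε : ℝ} (hε : 0 < ε) :
    ∃ B ⊆ A, MeasurableSet B ∧ 0 < μ.real B ∧ μ.real B ≤ ε := by
  have key : ∀ n : ℕ, ∃ B ⊆ A, MeasurableSet B ∧ 0 < μ.real B ∧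
      μ.real B ≤ μ.real A * (1 / 2) ^ n := by
    intro n
    induction n with
    | zero => exact ⟨A, subset_rfl, hA, hA0, by simp⟩
    | succ n ih =>
      obtain ⟨B, hBA, hB, hB0, hBn⟩ := ih
      obtain ⟨C, hCB, hC, hC0, hCn⟩ := exists_subset_measureReal_le_half hμ hB hB0
      exact ⟨C, hCB.trans hBA, hC, hC0, by rw [pow_succ]; linarith⟩
  obtain ⟨n, hn⟩ := exists_pow_lt_of_lt_one (div_pos hε hA0) (by norm_num : (1 / 2 : ℝ) < 1)
  obtain ⟨B, hBA, hB, hB0, hBn⟩ := key n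
  refine ⟨B, hBA, hB, hB0, hBn.trans ?_⟩
  rw [lt_div_iff₀ hA0] at hn
  linarith

/-- Sierpiński's theorem: a finite atomless measure takes all intermediate values. -/
theorem exists_subset_measureReal_eq [IsFiniteMeasure μ] (hμ : ∀ B, ¬ IsMeasureAtom μ B)
    {A : Set T} (hA : MeasurableSet A) {c : ℝ} (hc : 0 ≤ c) (hcA : c ≤ μ.real A) :
    ∃ B ⊆ A, MeasurableSet B ∧ μ.real B = c := by
  let P : Set T → Prop := fun B => B ⊆ A ∧ MeasurableSet B ∧ μ.real B ≤ c
  -- Greedy enlargement: `B'` realizes at least half of the supremum of the possible gains in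
  -- measure, which itself need not be attained.
  have step : ∀ B : {B // P B}, ∃ B' : {B // P B}, B.1 ⊆ B'.1 ∧
      ∀ C, P C → B.1 ⊆ C → μ.real C - μ.real B.1 ≤ 2 * (μ.real B'.1 - μ.real B.1) := by
    rintro ⟨B, hB⟩
    let V : Set ℝ := {r | ∃ C, P C ∧ B ⊆ C ∧ r = μ.real C - μ.real B}
    have hV0 : (0 : ℝ) ∈ V := ⟨B, hB, subset_rfl, by simp⟩
    have hVb : BddAbove V := by
      refine ⟨c, ?_⟩
      rintro _ ⟨C, hC, -, rfl⟩
      linarith [hC.2.2, measureReal_nonneg (μ := μ) (s := B)]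
    rcases (le_csSup hVb hV0).eq_or_lt with h | h
    · refine ⟨⟨B, hB⟩, subset_rfl, fun C hC hBC => ?_⟩
      have := le_csSup hVb ⟨C, hC, hBC, rfl⟩
      simp only
      linarith
    · obtain ⟨_, ⟨C, hC, hBC, rfl⟩, hlt⟩ := exists_lt_of_lt_csSup ⟨0, hV0⟩ (half_lt_self h)
      refine ⟨⟨C, hC⟩, hBC, fun D hD hBD => ?_⟩
      have := le_csSup hVb ⟨D, hD, hBD, rfl⟩
      simp only
      linarith
  choose next hsub hnext using step
  let B : ℕ → {B // P B} := fun n =>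
    next^[n] ⟨∅, Set.empty_subset _, MeasurableSet.empty, by simpa using hc⟩
  have hsucc : ∀ n, B (n + 1) = next (B n) := fun n => Function.iterate_succ_apply' _ _ _
  have hmono : Monotone fun n => (B n).1 := monotone_nat_of_le_succ fun n => by
    simp only [hsucc]; exact hsub _
  set D : Set T := ⋃ n, (B n).1 with hD
  have hDm : MeasurableSet D := MeasurableSet.iUnion fun n => (B n).2.2.1
  have hDA : D ⊆ A := Set.iUnion_subset fun n => (B n).2.1
  have hlim : Filter.Tendsto (fun n => μ.real (B n).1) Filter.atTop (nhds (μ.real D)) :=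
    (ENNReal.tendsto_toReal (measure_ne_top μ D)).comp (tendsto_measure_iUnion_atTop hmono)
  have hDc : μ.real D ≤ c := le_of_tendsto' hlim fun n => (B n).2.2.2
  refine ⟨D, hDA, hDm, hDc.antisymm (not_lt.1 fun hlt => ?_)⟩
  have hdiff : μ.real (A \ D) = μ.real A - μ.real D := measureReal_sdiff hDA hDm
  obtain ⟨C, hCs, hC, hC0, hCle⟩ := exists_subset_measureReal_le hμ (hA.diff hDm)
    (by linarith : 0 < μ.real (A \ D)) (sub_pos.2 hlt)
  have hunion : μ.real (D ∪ C) = μ.real D + μ.real C :=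
    measureReal_union (Set.disjoint_sdiff_right.mono_right hCs) hC
  have hP : P (D ∪ C) := ⟨Set.union_subset hDA (hCs.trans Set.sdiff_subset), hDm.union hC, by
    linarith⟩
  -- `D ∪ C` competes at every stage, so every gain is at least half of what it offers. The gains
  -- tend to `0`, which forces `μ.real C ≤ 0`.
  have hineq : ∀ n, μ.real (D ∪ C) - μ.real (B n).1 ≤
      2 * (μ.real (B (n + 1)).1 - μ.real (B n).1) := fun n => by
    rw [hsucc]
    exact hnext _ _ hP ((Set.subset_iUnion (fun n => (B n).1) n).trans Set.subset_union_left)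
  have := le_of_tendsto_of_tendsto' (tendsto_const_nhds.sub hlim)
    (((hlim.comp (Filter.tendsto_add_atTop_nat 1)).sub hlim).const_mul 2) hineq
  linarith

/-- An atomless finite measure admits sets splitting the integral of a simple function in a given
proportion. -/
theorem exists_setIntegral_simpleFunc_eq_smul [IsFiniteMeasure μ] (hμ : ∀ B, ¬ IsMeasureAtom μ B)
    {F : Type*} [NormedAddCommGroup F] [NormedSpace ℝ F] [CompleteSpace F]
    (s : SimpleFunc T F) {r : ℝ} (hr : r ∈ Set.Icc (0 : ℝ) 1) :
    ∃ R, MeasurableSet R ∧ ∫ t in R, s t ∂μ = r • ∫ t, s t ∂μ := by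
  -- The set is assembled from the share `r` of each fibre of `s`.
  have hex : ∀ x : F, ∃ B ⊆ s ⁻¹' {x}, MeasurableSet B ∧ μ.real B = r * μ.real (s ⁻¹' {x}) :=
    fun x => exists_subset_measureReal_eq hμ (s.measurableSet_fiber x)
      (mul_nonneg hr.1 measureReal_nonneg) (mul_le_of_le_one_left measureReal_nonneg hr.2)
  choose B hBs hBm hB using hex
  have hRm : MeasurableSet (⋃ x ∈ s.range, B x) := Finset.measurableSet_biUnion _ fun x _ => hBm x
  refine ⟨⋃ x ∈ s.range, B x, hRm, ?_⟩
  have hfib : ∀ x ∈ s.range, s ⁻¹' {x} ∩ (⋃ x ∈ s.range, B x) = B x := by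
    intro x hx
    ext t
    simp only [Set.mem_inter_iff, Set.mem_preimage, Set.mem_singleton_iff, Set.mem_iUnion,
      exists_prop]
    constructor
    · rintro ⟨rfl, y, -, hy⟩
      have : s t = y := hBs y hy
      rwa [this]
    · exact fun h => ⟨hBs x h, x, hx, h⟩
  have hi : ∀ ν : Measure T, IsFiniteMeasure ν → Integrable s ν := fun ν _ =>
    s.integrable_of_isFiniteMeasure
  rw [SimpleFunc.integral_eq_sum s (hi _ inferInstance),
    SimpleFunc.integral_eq_sum s (hi _ inferInstance), Finset.smul_sum]
  refine Finset.sum_congr rfl fun x hx => ?_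
  rw [measureReal_restrict_apply (s.measurableSet_fiber x), hfib x hx, hB, mul_smul]

/-- Approximate Lyapunov convexity: for an atomless finite measure, every neighbourhood of a
proportion `r` of the integral of `h` contains the integral of `h` over some measurable set. -/
theorem exists_setIntegral_mem_of_mem_nhds [IsFiniteMeasure μ] (hμ : ∀ B, ¬ IsMeasureAtom μ B)
    {F : Type*} [NormedAddCommGroup F] [NormedSpace ℝ F] [CompleteSpace F]
    {h : T → F} (hh : Integrable h μ) {r : ℝ} (hr : r ∈ Set.Icc (0 : ℝ) 1)
    {O : Set F} (hO : O ∈ nhds (r • ∫ t, h t ∂μ)) :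
    ∃ R, MeasurableSet R ∧ ∫ t in R, h t ∂μ ∈ O := by
  obtain ⟨ε, hε, hball⟩ := Metric.mem_nhds_iff.1 hO
  obtain ⟨s, hs, -⟩ := (memLp_one_iff_integrable.2 hh).exists_simpleFunc_eLpNorm_sub_lt
    ENNReal.one_ne_top (ENNReal.ofReal_pos.2 (half_pos hε)).ne'
  have hsi : Integrable s μ := s.integrable_of_isFiniteMeasure
  have hsub : Integrable (fun t => h t - s t) μ := hh.sub hsi
  have hnorm : ∫ t, ‖h t - s t‖ ∂μ < ε / 2 := by
    rw [eLpNorm_one_eq_lintegral_enorm] at hs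
    rw [integral_norm_eq_lintegral_enorm hsub.aestronglyMeasurable]
    exact (ENNReal.toReal_lt_of_lt_ofReal hs)
  obtain ⟨R, hR, hRs⟩ := exists_setIntegral_simpleFunc_eq_smul hμ s hr
  refine ⟨R, hR, hball ?_⟩
  rw [mem_ball_iff_norm]
  -- The simple part is split exactly, so only two error terms below `ε / 2` remain.
  have e : ∫ t in R, h t ∂μ - r • ∫ t, h t ∂μ =
      ∫ t in R, (h t - s t) ∂μ - r • ∫ t, (h t - s t) ∂μ := by
    rw [integral_sub hh hsi, integral_sub hh.integrableOn hsi.integrableOn, hRs, smul_sub]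
    abel
  have h1 : ‖∫ t in R, (h t - s t) ∂μ‖ ≤ ∫ t, ‖h t - s t‖ ∂μ :=
    (norm_integral_le_integral_norm _).trans
      (setIntegral_le_integral hsub.norm (Filter.Eventually.of_forall fun _ => norm_nonneg _))
  have h2 : ‖r • ∫ t, (h t - s t) ∂μ‖ ≤ ∫ t, ‖h t - s t‖ ∂μ := by
    rw [norm_smul, Real.norm_of_nonneg hr.1]
    exact (mul_le_of_le_one_left (norm_nonneg _) hr.2).trans (norm_integral_le_integral_norm _)
  rw [e]
  linarith [norm_sub_le (∫ t in R, (h t - s t) ∂μ) (r • ∫ t, (h t - s t) ∂μ)]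

/-- The part of a measure on a set without atoms is atomless. -/
theorem not_isMeasureAtom_restrict {A : Set T} (hA : MeasurableSet A)
    (h : ∀ B ⊆ A, ¬ IsMeasureAtom μ B) (B : Set T) : ¬ IsMeasureAtom (μ.restrict A) B := by
  rintro ⟨hB, hB0, hB1⟩
  refine h (B ∩ A) Set.inter_subset_right ⟨hB.inter hA, by rwa [Measure.restrict_apply hB] at hB0,
    fun C hC hCm => ?_⟩
  have := hB1 C (hC.trans Set.inter_subset_left) hCm
  rwa [Measure.restrict_apply hCm, Measure.restrict_apply (hB.diff hCm),
    Set.inter_eq_left.2 (hC.trans Set.inter_subset_right), ← Set.inter_sdiff_right_comm] at this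

end Atomless

/-! ### Events and random variables of a partition. -/

section Partition

variable {Ω : Type*}

/-- Events of the `σ`-algebra generated by a partition do not separate points of a cell. -/
theorem mem_iff_mem_of_measurableSet_partitionAlgebra {r : Setoid Ω} {s : Set Ω}
    (hs : MeasurableSet[partitionAlgebra r] s) {ω ω' : Ω} (h : r ω ω') : ω ∈ s ↔ ω' ∈ s := by
  induction s, hs using MeasurableSpace.generateFrom_induction with
  | hC C hC _ =>
    obtain ⟨y, rfl⟩ := hC
    exact ⟨fun h' => r.trans (r.symm h) h', fun h' => r.trans h h'⟩
  | empty => rfl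
  | compl s _ ih => exact not_congr ih
  | iUnion s _ ih => simp only [Set.mem_iUnion, ih]

/-- Random variables measurable with respect to a partition are constant on its cells. -/
theorem eq_of_measurable_partitionAlgebra {β : Type*} [MeasurableSpace β]
    [MeasurableSingletonClass β] {r : Setoid Ω} {φ : Ω → β}
    (hφ : Measurable[partitionAlgebra r] φ) {ω ω' : Ω} (h : r ω ω') : φ ω = φ ω' :=
  ((mem_iff_mem_of_measurableSet_partitionAlgebra (hφ (measurableSet_singleton (φ ω))) h).1
    rfl : φ ω' = φ ω).symm

end Partition

/-! ### Averages of bundles under a quasi-concave utility. -/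

theorem convex_orthant (ℓ : ℕ) : Convex ℝ (orthant ℓ) := convex_Ici (0 : Fin ℓ → ℝ)

theorem isClosed_orthant (ℓ : ℕ) : IsClosed (orthant ℓ) := isClosed_Ici (a := (0 : Fin ℓ → ℝ))

theorem sup_zero_mem_orthant {ℓ : ℕ} (x : Fin ℓ → ℝ) : x ⊔ 0 ∈ orthant ℓ :=
  (le_sup_right : (0 : Fin ℓ → ℝ) ≤ x ⊔ 0)

/-- Precomposing with the positive part extends a continuous function on the orthant to the
whole space. -/
theorem ContinuousOn.continuous_comp_sup_zero {ℓ : ℕ} {u : (Fin ℓ → ℝ) → ℝ}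
    (hu : ContinuousOn u (orthant ℓ)) : Continuous fun x => u (x ⊔ 0) :=
  hu.comp_continuous (continuous_pi fun k => (continuous_apply k).sup continuous_const) sup_zero_mem_orthant

section Average

variable {T : Type*} [MeasurableSpace T] {μ : Measure T} {ℓ : ℕ} {u : (Fin ℓ → ℝ) → ℝ}
  {F : T → Fin ℓ → ℝ}

theorem aemeasurable_comp_of_mem_orthant (hu : ContinuousOn u (orthant ℓ))
    (hF : AEStronglyMeasurable F μ) (hmem : ∀ t, F t ∈ orthant ℓ) :
    AEMeasurable (fun t => u (F t)) μ := by
  have h := hu.continuous_comp_sup_zero.measurable.comp_aemeasurable hF.aemeasurable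
  refine h.congr (Filter.Eventually.of_forall fun t => ?_)
  simp only [Function.comp_apply, sup_eq_left.2 (show (0 : Fin ℓ → ℝ) ≤ F t from hmem t)]

/-- The average of bundles that are all at least as good as a given level is as good as it. -/
theorem le_average_of_quasiconcaveOn [IsFiniteMeasure μ] (hμ : μ ≠ 0)
    (hu : ContinuousOn u (orthant ℓ)) (hq : QuasiconcaveOn ℝ (orthant ℓ) u)
    (hF : Integrable F μ) (hmem : ∀ t, F t ∈ orthant ℓ) {c : ℝ} (hc : ∀ᵐ t ∂μ, c ≤ u (F t)) :
    ⨍ t, F t ∂μ ∈ orthant ℓ ∧ c ≤ u (⨍ t, F t ∂μ) := by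
  have : NeZero μ := ⟨hμ⟩
  -- Upper level sets are closed and convex, so they contain averages of their points.
  have hcl : IsClosed {x ∈ orthant ℓ | c ≤ u x} :=
    hu.preimage_isClosed_of_isClosed (isClosed_orthant ℓ) isClosed_Ici
  exact (hq c).average_mem hcl (hc.mono fun t ht => ⟨hmem t, ht⟩) hF

/-- If almost all bundles are at least as good as their average, they are as good as it. -/
theorem ae_eq_of_average_le [IsFiniteMeasure μ]
    (hu : ContinuousOn u (orthant ℓ)) (hm : StrictMonoOn u (orthant ℓ))
    (hq : QuasiconcaveOn ℝ (orthant ℓ) u)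
    (hF : Integrable F μ) (hmem : ∀ t, F t ∈ orthant ℓ)
    (hle : ∀ᵐ t ∂μ, u (⨍ s, F s ∂μ) ≤ u (F t)) :
    ∀ᵐ t ∂μ, u (F t) = u (⨍ s, F s ∂μ) := by
  rcases eq_or_ne μ 0 with rfl | hμ
  · simp
  have hmeas := aemeasurable_comp_of_mem_orthant hu hF.aestronglyMeasurable hmem
  set z := ⨍ s, F s ∂μ with hz
  have hzmem : z ∈ orthant ℓ := (le_average_of_quasiconcaveOn hμ hu hq hF hmem hle).1
  suffices h : ∀ k : ℕ, ∀ᵐ t ∂μ, u (F t) < u z + 1 / (k + 1) by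
    filter_upwards [ae_all_iff.2 h, hle] with t ht ht'
    refine le_antisymm (le_of_forall_pos_lt_add fun ε hε => ?_) ht'
    obtain ⟨k, hk⟩ := exists_nat_one_div_lt hε
    exact (ht k).trans (by linarith)
  intro k
  by_contra hcon
  set c : ℝ := u z + 1 / (k + 1) with hc
  have hcz : u z < c := by
    have : (0 : ℝ) < 1 / (k + 1) := by positivity
    linarith
  set B : Set T := {t | c ≤ u (F t)} with hB
  have hBm : NullMeasurableSet B μ := nullMeasurableSet_le aemeasurable_const hmeas
  have hB0 : μ B ≠ 0 := by
    intro h0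
    exact hcon (by simpa only [ae_iff, not_lt] using h0)
  have hres : ∀ {A : Set T}, μ A ≠ 0 → μ.restrict A ≠ 0 := fun h h' =>
    h (Measure.restrict_eq_zero.1 h')
  have hp := le_average_of_quasiconcaveOn (hres hB0) hu hq hF.integrableOn hmem
    (ae_restrict_mem₀ hBm : ∀ᵐ t ∂μ.restrict B, c ≤ u (F t))
  -- If `B` were conull, its average would be `z`, which is worse than `c`.
  have hBc0 : μ Bᶜ ≠ 0 := by
    intro h0
    have e : μ.restrict B = μ := Measure.restrict_eq_self_of_ae_mem (by
      simpa [ae_iff, Set.compl_def] using h0)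
    rw [e] at hp
    linarith [hp.2]
  have hq' := le_average_of_quasiconcaveOn (hres hBc0) hu hq hF.integrableOn hmem
    (ae_restrict_of_ae hle)
  have hseg := average_mem_openSegment_compl_self hBm hB0 hBc0 hF
  rw [← hz] at hseg
  set p := ⨍ t in B, F t ∂μ
  set q := ⨍ t in Bᶜ, F t ∂μ
  obtain ⟨α, β, hα, hβ, hαβ, hsum⟩ := hseg
  have hp0 : (0 : Fin ℓ → ℝ) ≤ p := hp.1
  -- a slightly smaller bundle than `p` is still better than the average
  have hcont : Filter.Tendsto (fun θ : ℝ => u ((θ • p) ⊔ 0)) (nhds 1) (nhds (u p)) := by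
    have := (hu.continuous_comp_sup_zero.comp (continuous_id.smul continuous_const :
      Continuous fun θ : ℝ => θ • p)).tendsto 1
    simpa [Function.comp_def, sup_eq_left.2 hp0] using this
  obtain ⟨θ, hθ, hθ0, hθ1⟩ : ∃ θ : ℝ, u z < u ((θ • p) ⊔ 0) ∧ 0 < θ ∧ θ < 1 := by
    have h1 := (hcont.eventually_const_lt (hcz.trans_le hp.2)).filter_mono
      (nhdsWithin_le_nhds (s := Set.Iio 1))
    have h2 : ∀ᶠ θ : ℝ in nhdsWithin 1 (Set.Iio 1), 0 < θ :=
      nhdsWithin_le_nhds (lt_mem_nhds one_pos)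
    exact (h1.and (h2.and self_mem_nhdsWithin)).exists
  have hθp : (0 : Fin ℓ → ℝ) ≤ θ • p := smul_nonneg hθ0.le hp0
  rw [sup_eq_left.2 hθp] at hθ
  -- Needed for `θ • p < p`: the mixture of `θ • p` and `q` then lies strictly below `z`, although
  -- quasi-concavity makes it at least as good.
  have hpne : p ≠ 0 := by
    rintro h0
    have : u p ≤ u z := hm.monotoneOn hp.1 hzmem (h0 ▸ hzmem)
    linarith [hp.2]
  have hmid := hq (u z) ⟨hθp, hθ.le⟩ hq' hα.le hβ.le hαβ
  have hlt : α • θ • p + β • q < z := by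
    rw [← hsum]
    refine add_lt_add_of_lt_of_le ?_ le_rfl
    refine smul_lt_smul_of_pos_left ?_ hα
    have : θ • p < (1 : ℝ) • p := smul_lt_smul_of_pos_right hθ1 (lt_of_le_of_ne hp0 hpne.symm)
    rwa [one_smul] at this
  exact absurd (hm hmid.1 hzmem hlt) (not_lt.2 hmid.2)

end Average

/-! ### From an improvement in one state to fine blocking. -/

namespace Economy

variable {Ω T : Type*} [mΩ : MeasurableSpace Ω] [MeasurableSpace T] {ℓ n : ℕ}

/-- Agents that share all their information form a communication system of a coalition in which
every information partition is present. -/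
theorem isCommunicationSystem_of_types_eq_univ {E : Economy Ω T ℓ} {Q : Fin n → Setoid Ω}
    (h5 : E.A5 Q) {S : Set T} (hS : MeasurableSet S) (htypes : ∀ i, i ∈ E.types Q S) :
    E.IsCommunicationSystem Q S fun _ => mΩ where
  le _ _ := le_rfl
  measurableSet_eq H _ := by
    by_cases h : mΩ = H <;> simp [h, hS]
  info_le := Filter.Eventually.of_forall fun t _ => by
    refine ⟨MeasurableSpace.generateFrom_le fun C hC => E.measurableSet_cell t C hC, ?_⟩
    have : (⨅ i ∈ E.types Q S, Q i) = ⨅ i, Q i := by simp [htypes]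
    rw [jointInfo, this, h5.2.2.2]

/-- A coalition with all information partitions that can improve upon `f` in a single state of
nature fine blocks `f`. -/
theorem isFineBlockedBy_of_state {E : Economy Ω T ℓ} {Q : Fin n → Setoid Ω}
    (h1 : E.A1') (h2 : E.A2) (h5 : E.A5 Q) {f : T → Ω → (Fin ℓ → ℝ)} (hf : E.IsAllocation f)
    {S : Set T} (hS : MeasurableSet S) (htypes : ∀ i, i ∈ E.types Q S) (ω₀ : Ω)
    {g₀ : T → Fin ℓ → ℝ} (hmem : ∀ t, g₀ t ∈ orthant ℓ) (hint : IntegrableOn g₀ S E.μ)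
    (hfeas : ∫ t in S, g₀ t ∂E.μ = ∫ t in S, E.a t ω₀ ∂E.μ)
    (hpref : ∀ᵐ t ∂E.μ, t ∈ S → E.U t ω₀ (f t ω₀) < E.U t ω₀ (g₀ t)) :
    E.IsFineBlockedBy Q f S := by
  classical
  have := E.isProbabilityMeasure_P
  set R : Setoid Ω := ⨅ i, Q i with hR
  have hRm : partitionAlgebra R = mΩ := h5.2.2.2
  set C : Set Ω := {ω | R ω ω₀} with hC
  have hCm : MeasurableSet C := by
    rw [← hRm]
    exact MeasurableSpace.measurableSet_generateFrom (R.mem_classes ω₀)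
  have const : ∀ {β : Type} [MeasurableSpace β] [MeasurableSingletonClass β] {φ : Ω → β},
      Measurable φ → ∀ ω ∈ C, φ ω = φ ω₀ := by
    intro β _ _ φ hφ ω hω
    have hφ' : Measurable[partitionAlgebra R] φ := by rwa [hRm]
    exact eq_of_measurable_partitionAlgebra hφ' hω
  have hameas : ∀ t, Measurable (E.a t) := fun t => h1.1.comp measurable_prodMk_left
  have ha : ∀ t, ∀ ω ∈ C, E.a t ω = E.a t ω₀ := fun t => const (hameas t)
  have hfc : ∀ t, ∀ ω ∈ C, f t ω = f t ω₀ := fun t => const (hf.measurable t)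
  have hU : ∀ t, ∀ x ∈ orthant ℓ, ∀ ω ∈ C, E.U t ω x = E.U t ω₀ x := fun t x hx =>
    const ((h2 x hx).comp measurable_prodMk_left)
  -- Off the event `C` and off the coalition everybody keeps the endowment, which makes `g` feasible
  -- in every state.
  let g : T → Ω → (Fin ℓ → ℝ) := fun t ω => if ω ∈ C ∧ t ∈ S then g₀ t else E.a t ω
  have hgout : ∀ ω ∉ C, (fun t => g t ω) = fun t => E.a t ω := fun ω hω => by
    funext t
    simp [g, hω]
  have hgin : ∀ ω ∈ C, (fun t => g t ω) = S.piecewise g₀ fun t => E.a t ω := fun ω hω => by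
    funext t
    simp [g, hω, Set.piecewise]
  have hgS : ∀ ω ∈ C, ∀ t ∈ S, g t ω = g₀ t := fun ω hω t ht => by simp [g, hω, ht]
  have hSint : ∀ ω ∈ C, ∫ t in S, E.a t ω ∂E.μ = ∫ t in S, E.a t ω₀ ∂E.μ := fun ω hω =>
    setIntegral_congr_fun hS fun t _ => ha t ω hω
  have halloc : E.IsAllocation g :=
    { mem := fun t ω => by
        by_cases h : ω ∈ C ∧ t ∈ S
        · simp only [g, h, and_self, if_true]; exact hmem t
        · simp only [g, h, if_false]; exact E.a_mem t ω
      integrable := fun ω => by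
        by_cases h : ω ∈ C
        · rw [hgin ω h]
          exact Integrable.piecewise hS hint (h1.2.1 ω).integrableOn
        · rw [hgout ω h]
          exact h1.2.1 ω
      measurable := fun t => by
        by_cases h : t ∈ S
        · simp only [g, h, and_true]
          exact Measurable.ite hCm measurable_const (hameas t)
        · simpa [g, h] using hameas t
      feasible := fun ω => by
        by_cases h : ω ∈ C
        · rw [hgin ω h, integral_piecewise hS hint (h1.2.1 ω).integrableOn, hfeas, ← hSint ω h,
            integral_add_compl hS (h1.2.1 ω)]
        · rw [hgout ω h] }
  have key : ∀ t, ∀ x : Ω → (Fin ℓ → ℝ), (∀ ω ∈ C, x ω = x ω₀) → x ω₀ ∈ orthant ℓ →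
      (C.indicator fun ω => E.U t ω (x ω)) = C.indicator fun _ => E.U t ω₀ (x ω₀) := by
    intro t x hx hx0
    refine Set.indicator_congr fun ω hω => ?_
    rw [hx ω hω, hU t _ hx0 ω hω]
  have hω₀ : ω₀ ∈ C := R.refl ω₀
  have kint : ∀ t, ∀ x : Ω → (Fin ℓ → ℝ), (∀ ω ∈ C, x ω = x ω₀) → x ω₀ ∈ orthant ℓ →
      IntegrableOn (fun ω => E.U t ω (x ω)) C (E.P t) := by
    intro t x hx hx0
    rw [← integrable_indicator_iff hCm, key t x hx hx0]
    exact (integrable_const _).indicator hCm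
  refine ⟨g, fun _ => mΩ, C, halloc, isCommunicationSystem_of_types_eq_univ h5 hS htypes,
    ⟨ω₀, hω₀⟩, fun _ _ => hCm, fun ω hω => ⟨?_, ?_⟩⟩
  · rw [hSint ω hω, ← hfeas]
    exact setIntegral_congr_fun hS fun t ht => hgS ω hω t ht
  · filter_upwards [hpref] with t ht htS
    have hgc : ∀ ω ∈ C, g t ω = g t ω₀ := fun ω hω => by
      rw [hgS ω hω t htS, hgS ω₀ hω₀ t htS]
    refine ⟨kint t _ (hfc t) (hf.mem t ω₀), kint t _ hgc (halloc.mem t ω₀), ?_⟩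
    intro φ ψ hφ hψ
    -- Restricted to `C` the utilities are measurable, so each is its own only version; this covers
    -- the case of a `C` null under `E.P t`.
    have hm : ∀ c : ℝ, Measurable (C.indicator fun _ : Ω => c) := fun c =>
      measurable_const.indicator hCm
    have e1 := hφ.eq_self (by rw [key t _ (hfc t) (hf.mem t ω₀)]; exact hm _)
    have e2 := hψ.eq_self (by rw [key t _ hgc (halloc.mem t ω₀)]; exact hm _)
    rw [e1, e2, key t _ (hfc t) (hf.mem t ω₀), key t _ hgc (halloc.mem t ω₀),
      Set.indicator_of_mem hω, Set.indicator_of_mem hω, hgS ω₀ hω₀ t htS]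
    exact ht htS

end Economy

/-! ### Blocking by large agents together with a sample of small agents. -/

/-- In an atomless part `A` of a finite measure space, there are sets over which the integral of `h`
is close to a given proportion of the one over `A`, and which meet every set of a finite family
that `A` meets (up to null sets). -/
theorem exists_subset_setIntegral_mem_and_measure_inter_pos {T : Type*} [MeasurableSpace T]
    {μ : Measure T} [IsFiniteMeasure μ] {A : Set T} (hA : MeasurableSet A)
    (hatom : ∀ B ⊆ A, ¬ IsMeasureAtom μ B)
    {V : Type*} [NormedAddCommGroup V] [NormedSpace ℝ V] [CompleteSpace V]
    {h : T → V} (hh : Integrable h μ) {ι : Type*} [Fintype ι] {B : ι → Set T}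
    (hB : ∀ i, MeasurableSet (B i)) {r : ℝ} (hr0 : 0 < r) (hr1 : r ≤ 1)
    {O : Set V} (hO : O ∈ nhds (r • ∫ t in A, h t ∂μ)) :
    ∃ R ⊆ A, MeasurableSet R ∧ ∫ t in R, h t ∂μ ∈ O ∧
      ∀ i, 0 < μ (A ∩ B i) → 0 < μ (R ∩ B i) := by
  -- Adjoining the indicators of the `B i` to `h` makes one application of the convexity result
  -- control the measures `μ (R ∩ B i)` as well.
  let q : T → ι → ℝ := fun t i => (B i).indicator 1 t
  have hqi : ∀ i, Integrable (fun t => q t i) μ := fun i =>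
    (integrable_const (1 : ℝ)).indicator (hB i)
  have hq : Integrable q μ := Integrable.of_eval hqi
  have hpair : Integrable (fun t => (h t, q t)) μ := hh.prodMk hq
  have hint : ∀ C : Set T, ∫ t in C, (h t, q t) ∂μ =
      (∫ t in C, h t ∂μ, fun i => μ.real (C ∩ B i)) := fun C => by
    refine Prod.ext (fst_integral hpair.integrableOn) ?_
    rw [snd_integral hpair.integrableOn]
    funext i
    rw [eval_integral fun i => (hqi i).integrableOn, integral_indicator_one (hB i),
      measureReal_restrict_apply (hB i), Set.inter_comm]
  let O' : Set (V × (ι → ℝ)) :=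
    {p | p.1 ∈ O ∧ ∀ i, 0 < μ (A ∩ B i) → 0 < p.2 i}
  have hO' : O' ∈ nhds (r • ∫ t in A, (h t, q t) ∂μ) := by
    rw [hint A]
    refine Filter.inter_mem (continuous_fst.continuousAt.preimage_mem_nhds hO)
      (Filter.eventually_all.2 fun i => ?_)
    by_cases hi : 0 < μ (A ∩ B i)
    · have hpos : 0 < (r • (∫ t in A, h t ∂μ, fun i => μ.real (A ∩ B i))).2 i :=
        mul_pos hr0 (ENNReal.toReal_pos hi.ne' (measure_ne_top _ _))
      have hc : Continuous fun p : V × (ι → ℝ) => p.2 i :=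
        (continuous_apply i).comp continuous_snd
      exact (hc.continuousAt.eventually_const_lt hpos).mono fun p hp _ => hp
    · exact Filter.Eventually.of_forall fun p hp => absurd hp hi
  obtain ⟨R, hR, hRO⟩ := exists_setIntegral_mem_of_mem_nhds
    (not_isMeasureAtom_restrict hA hatom) hpair.integrableOn ⟨hr0.le, hr1⟩ hO'
  rw [Measure.restrict_restrict hR, hint] at hRO
  refine ⟨R ∩ A, Set.inter_subset_right, hR.inter hA, hRO.1, fun i hi => ?_⟩
  exact (ENNReal.toReal_pos_iff.1 (hRO.2 i hi)).1

namespace Economy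

variable {Ω T : Type*} [mΩ : MeasurableSpace Ω] [MeasurableSpace T] {ℓ n : ℕ}

theorem measurableSet_T₁ (E : Economy Ω T ℓ) : MeasurableSet E.T₁ :=
  MeasurableSet.sUnion E.countable_atoms fun A hA => (E.isMeasureAtom_of_mem A hA).1

theorem measure_T₁_pos {E : Economy Ω T ℓ} (h : E.atoms.Nonempty) : 0 < E.μ E.T₁ := by
  obtain ⟨A, hA⟩ := h
  exact (E.isMeasureAtom_of_mem A hA).2.1.trans_le (measure_mono (Set.subset_sUnion_of_mem hA))

/-- If some large agents are worse off than with the average bundle of the large agents, by a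
margin, then they block together with a representative sample of the small agents. -/
theorem exists_isFineBlockedBy_of_lt_average {E : Economy Ω T ℓ} {Q : Fin n → Setoid Ω}
    (h1 : E.A1') (h2 : E.A2) (h3 : E.A3) (h5 : E.A5 Q) (h6 : E.A6)
    {f : T → Ω → (Fin ℓ → ℝ)} (hf : E.IsAllocation f) (ω : Ω) {t₁ : T} (ht₁ : t₁ ∈ E.T₁)
    {D : Set T} (hD : MeasurableSet D) (hDT : D ⊆ E.T₁) (hD0 : 0 < E.μ D) {c : ℝ}
    (hDc : ∀ t ∈ D, E.U t₁ ω (f t ω) ≤ c)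
    (hb : ⨍ t in E.T₁, f t ω ∂E.μ ∈ orthant ℓ)
    (hc : c < E.U t₁ ω (⨍ t in E.T₁, f t ω ∂E.μ)) :
    ∃ S, E.IsCoalition S ∧ E.IsFineBlockedBy Q f S := by
  classical
  have := E.isFiniteMeasure_μ
  have hT₁ := E.measurableSet_T₁
  set μ := E.μ
  set u := E.U t₁ ω with hu
  set a₁ := E.a t₁ ω with ha₁
  set b := ⨍ t in E.T₁, f t ω ∂μ with hbdef
  set m := μ.real D with hm
  set M := μ.real E.T₁ with hM
  have hm0 : 0 < m := ENNReal.toReal_pos hD0.ne' (measure_ne_top _ _)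
  have hmM : m ≤ M := measureReal_mono hDT
  have hM0 : 0 < M := hm0.trans_le hmM
  have hucont := (h3 t₁ ω).1.continuous_comp_sup_zero
  have haT : ∀ t ∈ E.T₁, E.a t ω = a₁ := fun t ht => congrFun (h6 t ht t₁ ht₁).2.2.1 ω
  have ha₁pos : ∀ k, 0 < a₁ k := by
    obtain ⟨t, htD, ht⟩ := Set.nonempty_def.1 (nonempty_of_measure_ne_zero
      (s := D ∩ {t | ∀ k, 0 < E.a t ω k}) (by
        rw [measure_inter_conull (mem_ae_iff.1 (h1.2.2 ω))]
        exact hD0.ne'))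
    rw [← haT t (hDT htD)]
    exact ht
  have hb0 : (0 : Fin ℓ → ℝ) ≤ b := hb
  -- a strictly positive bundle near the average that is still better
  obtain ⟨η, hηc, hη0, hη1⟩ : ∃ η : ℝ, c < u ((η • a₁ + (1 - η) • b) ⊔ 0) ∧ 0 < η ∧ η < 1 := by
    have hcont : Continuous fun η : ℝ => u ((η • a₁ + (1 - η) • b) ⊔ 0) :=
      hucont.comp (by fun_prop : Continuous fun η : ℝ => η • a₁ + (1 - η) • b)
    have h0 : c < u (((0 : ℝ) • a₁ + (1 - (0 : ℝ)) • b) ⊔ 0) := by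
      simpa [sup_eq_left.2 hb0] using hc
    have e1 := (hcont.continuousAt.eventually_const_lt h0).filter_mono
      (nhdsWithin_le_nhds (s := Set.Ioi 0))
    have e2 : ∀ᶠ η : ℝ in nhdsWithin 0 (Set.Ioi 0), η < 1 :=
      nhdsWithin_le_nhds (gt_mem_nhds one_pos)
    obtain ⟨η, h, h', h''⟩ := (e1.and (e2.and self_mem_nhdsWithin)).exists
    exact ⟨η, h, h'', h'⟩
  set z := η • a₁ + (1 - η) • b with hz
  have hzpos : ∀ k, 0 < z k := fun k =>
    add_pos_of_pos_of_nonneg (mul_pos hη0 (ha₁pos k)) (mul_nonneg (by linarith) (hb0 k))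
  -- The factor `m / M` scales the trade of all large agents down to `D`; the factor `1 - η` turns
  -- the bundle left to `D` from `b` into `z`.
  set r : ℝ := m / M * (1 - η) with hr
  have hr0 : 0 < r := mul_pos (div_pos hm0 hM0) (by linarith)
  have hr1 : r ≤ 1 := mul_le_one₀ ((div_le_one hM0).2 hmM) (by linarith) (by linarith)
  have hdint : Integrable (fun t => f t ω - E.a t ω) μ := (hf.integrable ω).sub (h1.2.1 ω)
  have hT₀ : ∫ t in E.T₁ᶜ, (f t ω - E.a t ω) ∂μ = M • (a₁ - b) := by
    have e0 : ∫ t, (f t ω - E.a t ω) ∂μ = 0 := by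
      rw [integral_sub (hf.integrable ω) (h1.2.1 ω), hf.feasible ω, sub_self]
    have e1 : ∫ t in E.T₁, (f t ω - E.a t ω) ∂μ = M • (b - a₁) := by
      rw [integral_sub (hf.integrable ω).integrableOn (h1.2.1 ω).integrableOn,
        setIntegral_congr_fun hT₁ haT, setIntegral_const, hbdef, setAverage_eq, smul_sub,
        smul_inv_smul₀ hM0.ne']
    rw [← integral_add_compl hT₁ hdint, e1] at e0
    rw [eq_neg_of_add_eq_zero_right e0, ← smul_neg, neg_sub]
  -- The bundle of each member of `D` if `D` shares equally the cost of a net trade `p` of the small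
  -- agents.
  let y : (Fin ℓ → ℝ) → (Fin ℓ → ℝ) := fun p => a₁ - m⁻¹ • p
  have hy : Continuous y := by fun_prop
  have hyz : y (r • ∫ t in E.T₁ᶜ, (f t ω - E.a t ω) ∂μ) = z := by
    rw [hT₀]
    funext k
    simp only [y, hr, hz, Pi.sub_apply, Pi.add_apply, Pi.smul_apply, smul_eq_mul]
    field_simp
    ring
  have hO : {p | (∀ k, 0 < y p k) ∧ c < u (y p ⊔ 0)} ∈
      nhds (r • ∫ t in E.T₁ᶜ, (f t ω - E.a t ω) ∂μ) := by
    refine Filter.inter_mem (Filter.eventually_all.2 fun k => ?_) ?_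
    · refine ((continuous_apply k).comp hy).continuousAt.eventually_const_lt ?_
      rw [Function.comp_apply, hyz]
      exact hzpos k
    · refine (hucont.comp hy).continuousAt.eventually_const_lt ?_
      rw [Function.comp_apply, hyz]
      exact hηc
  obtain ⟨R, hRT, hR, ⟨hypos, hyc⟩, hRB⟩ := exists_subset_setIntegral_mem_and_measure_inter_pos
    hT₁.compl E.atomless_compl hdint h5.1 hr0 hr1 hO
  set p := ∫ t in R, (f t ω - E.a t ω) ∂μ with hp
  set x := y p with hx
  have hx0 : (0 : Fin ℓ → ℝ) ≤ x := fun k => (hypos k).le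
  -- The members of `D` give up the share `θ` of `x`, in total `(θ * m) • x`; spread evenly over the
  -- coalition, this makes the sample strictly better off too.
  obtain ⟨θ, hθc, hθ0, hθ1⟩ : ∃ θ : ℝ, c < u (((1 - θ) • x) ⊔ 0) ∧ 0 < θ ∧ θ < 1 := by
    have hcont : Continuous fun θ : ℝ => u (((1 - θ) • x) ⊔ 0) :=
      hucont.comp (by fun_prop : Continuous fun θ : ℝ => (1 - θ) • x)
    have h0 : c < u (((1 - (0 : ℝ)) • x) ⊔ 0) := by simpa using hyc
    have e1 := (hcont.continuousAt.eventually_const_lt h0).filter_mono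
      (nhdsWithin_le_nhds (s := Set.Ioi 0))
    have e2 : ∀ᶠ η : ℝ in nhdsWithin 0 (Set.Ioi 0), η < 1 :=
      nhdsWithin_le_nhds (gt_mem_nhds one_pos)
    obtain ⟨η, h, h', h''⟩ := (e1.and (e2.and self_mem_nhdsWithin)).exists
    exact ⟨η, h, h'', h'⟩
  have hθx : (0 : Fin ℓ → ℝ) ≤ (1 - θ) • x := smul_nonneg (by linarith) hx0
  rw [sup_eq_left.2 hθx] at hθc
  have hdisj : Disjoint R D := (disjoint_compl_left (a := E.T₁)).mono hRT hDT
  set S := R ∪ D with hS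
  have hSm : MeasurableSet S := hR.union hD
  have hS0 : 0 < μ S := hD0.trans_le (measure_mono Set.subset_union_right)
  have hSr : 0 < μ.real S := ENNReal.toReal_pos hS0.ne' (measure_ne_top _ _)
  -- everybody in the coalition receives the same bonus `w`
  set w := (θ * m / μ.real S) • x with hw
  have hwc : 0 < θ * m / μ.real S := div_pos (mul_pos hθ0 hm0) hSr
  have hw0 : (0 : Fin ℓ → ℝ) ≤ w := smul_nonneg hwc.le hx0
  -- Without commodities there is only one bundle, and `c < u b` fails.
  have hℓ : Nonempty (Fin ℓ) := by
    by_contra hemp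
    rw [not_nonempty_iff] at hemp
    obtain ⟨t, ht⟩ := nonempty_of_measure_ne_zero hD0.ne'
    have := hDc t ht
    rw [Subsingleton.elim (f t ω) b] at this
    linarith
  have hwpos : 0 < w := by
    refine lt_of_le_of_ne hw0 fun h => ?_
    obtain ⟨k⟩ := hℓ
    have := congrFun h k
    exact (mul_pos hwc (hypos k)).ne this
  let base : T → Fin ℓ → ℝ := D.piecewise (fun _ => (1 - θ) • x) fun t => f t ω
  have hbaseD : ∀ t ∈ D, base t = (1 - θ) • x := fun t ht => Set.piecewise_eq_of_mem _ _ _ ht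
  have hbaseR : ∀ t ∈ R, base t = f t ω := fun t ht =>
    Set.piecewise_eq_of_notMem _ _ _ (Set.disjoint_left.1 hdisj ht)
  have hbase0 : ∀ t, 0 ≤ base t := fun t => by
    by_cases ht : t ∈ D
    · rw [hbaseD t ht]; exact hθx
    · simp only [base, Set.piecewise_eq_of_notMem _ _ _ ht]; exact hf.mem t ω
  have hbasei : Integrable base μ :=
    Integrable.piecewise hD (integrable_const _).integrableOn (hf.integrable ω).integrableOn
  have hfeas : ∫ t in S, (base t + w) ∂μ = ∫ t in S, E.a t ω ∂μ := by
    have hpe : p = ∫ t in R, f t ω ∂μ - ∫ t in R, E.a t ω ∂μ :=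
      integral_sub (hf.integrable ω).integrableOn (h1.2.1 ω).integrableOn
    rw [integral_add hbasei.integrableOn (integrable_const _).integrableOn, setIntegral_const,
      setIntegral_union hdisj hD hbasei.integrableOn hbasei.integrableOn,
      setIntegral_union hdisj hD (h1.2.1 ω).integrableOn (h1.2.1 ω).integrableOn,
      setIntegral_congr_fun hR hbaseR, setIntegral_congr_fun hD hbaseD,
      setIntegral_congr_fun hD fun t ht => haT t (hDT ht), setIntegral_const, setIntegral_const,
      hw, sub_eq_iff_eq_add.1 hpe.symm]
    funext k
    simp only [hx, y, Pi.sub_apply, Pi.add_apply, Pi.smul_apply, smul_eq_mul, ← hm]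
    field_simp
    ring
  have htypes : ∀ i, i ∈ E.types Q S := by
    intro i
    -- A type with a non-null set of small agents is met by `R`. Any other type occurs among the
    -- large agents, who are all alike, so all of `D` has it.
    by_cases hi : 0 < μ (E.T₁ᶜ ∩ E.typeSet Q Set.univ i)
    · refine (hRB i hi).trans_le (measure_mono ?_)
      rintro t ⟨htR, -, ht⟩
      exact ⟨Or.inl htR, ht⟩
    · have hne : (E.typeSet Q Set.univ i ∩ E.T₁).Nonempty := by
        by_contra hemp
        rw [Set.not_nonempty_iff_eq_empty, ← Set.disjoint_iff_inter_eq_empty,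
          ← Set.subset_compl_iff_disjoint_right] at hemp
        rw [Set.inter_eq_right.2 hemp] at hi
        exact hi (h5.2.1 i)
      obtain ⟨s, ⟨-, hs⟩, hsT⟩ := hne
      refine hD0.trans_le (measure_mono fun t ht => ⟨Or.inr ht, ?_⟩)
      exact (h6 t (hDT ht) s hsT).1.trans hs
  refine ⟨S, ⟨hSm, hS0⟩, isFineBlockedBy_of_state h1 h2 h5 hf hSm htypes ω
    (g₀ := fun t => base t + w) (fun t => add_nonneg (hbase0 t) hw0)
    (hbasei.add (integrable_const _)).integrableOn hfeas
    (Filter.Eventually.of_forall fun t ht => ?_)⟩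
  have hgmem : base t + w ∈ orthant ℓ := add_nonneg (hbase0 t) hw0
  rcases ht with ht | ht
  · refine (h3 t ω).2 (hf.mem t ω) hgmem ?_
    rw [hbaseR t ht]
    exact lt_add_of_pos_right _ hwpos
  · have hEq := (h6 t (hDT ht) t₁ ht₁).2.1 ω
    rw [hEq (hf.mem t ω), hEq hgmem]
    refine (hDc t ht).trans_lt (hθc.trans ((h3 t₁ ω).2 hθx hgmem ?_))
    rw [hbaseD t ht]
    exact lt_add_of_pos_right _ hwpos

end Economy

/-! ### Conclusion. -/

theorem theorem4p1 {Ω T : Type*} [MeasurableSpace Ω] [MeasurableSpace T] {ℓ n : ℕ}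
    (E : Economy Ω T ℓ) (Q : Fin n → Setoid Ω)
    (h1 : E.A1') (h2 : E.A2) (h3 : E.A3) (h4 : E.A4') (h5 : E.A5 Q) (h6 : E.A6)
    (hlarge : E.atoms.Nonempty)
    (f : T → Ω → (Fin ℓ → ℝ)) (hf : f ∈ E.fineCore Q) :
    ∀ ω, ∀ᵐ t ∂E.μ, E.U t ω (E.average f t ω) = E.U t ω (f t ω) := by
  intro ω
  have := E.isFiniteMeasure_μ
  have := E.isComplete_μ
  obtain ⟨hfa, hcore⟩ := hf
  have hT₁ := E.measurableSet_T₁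
  have hpos := Economy.measure_T₁_pos hlarge
  have hres : E.μ.restrict E.T₁ ≠ 0 := fun h => hpos.ne' (Measure.restrict_eq_zero.1 h)
  obtain ⟨t₁, ht₁⟩ := nonempty_of_measure_ne_zero hpos.ne'
  have hb : ⨍ t in E.T₁, f t ω ∂E.μ ∈ orthant ℓ :=
    (convex_orthant ℓ).set_average_mem (isClosed_orthant ℓ) hpos.ne' (measure_ne_top _ _)
      (Filter.Eventually.of_forall fun t => hfa.mem t ω) (hfa.integrable ω).integrableOn
  have hmeas := aemeasurable_comp_of_mem_orthant (h3 t₁ ω).1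
    (hfa.integrable ω).aestronglyMeasurable fun t => hfa.mem t ω
  have hle : ∀ᵐ t ∂E.μ.restrict E.T₁,
      E.U t₁ ω (⨍ s in E.T₁, f s ω ∂E.μ) ≤ E.U t₁ ω (f t ω) := by
    -- Countably many margins reduce the claim to sets of agents that fall short of the average by a
    -- fixed amount, as blocking requires.
    suffices h : ∀ k : ℕ, ∀ᵐ t ∂E.μ.restrict E.T₁,
        E.U t₁ ω (⨍ s in E.T₁, f s ω ∂E.μ) - 1 / (k + 1) < E.U t₁ ω (f t ω) by
      filter_upwards [ae_all_iff.2 h] with t ht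
      refine le_of_forall_pos_lt_add fun ε hε => ?_
      obtain ⟨k, hk⟩ := exists_nat_one_div_lt hε
      linarith [ht k]
    intro k
    by_contra hcon
    set c : ℝ := E.U t₁ ω (⨍ s in E.T₁, f s ω ∂E.μ) - 1 / (k + 1) with hc
    have hlt : c < E.U t₁ ω (⨍ s in E.T₁, f s ω ∂E.μ) := by
      have : (0 : ℝ) < 1 / (k + 1) := by positivity
      linarith
    -- A coalition must be measurable, not just null-measurable; completeness of the measure
    -- provides this.
    have hBm : MeasurableSet {t | E.U t₁ ω (f t ω) ≤ c} :=
      (nullMeasurableSet_le hmeas aemeasurable_const).measurable_of_complete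
    have hD0 : 0 < E.μ ({t | E.U t₁ ω (f t ω) ≤ c} ∩ E.T₁) := by
      rw [pos_iff_ne_zero, ← Measure.restrict_apply hBm]
      intro h0
      exact hcon (by simpa only [ae_iff, not_lt] using h0)
    obtain ⟨S, hS, hblock⟩ := Economy.exists_isFineBlockedBy_of_lt_average h1 h2 h3 h5 h6 hfa ω ht₁
      (hBm.inter hT₁) Set.inter_subset_right hD0 (fun t ht => ht.1) hb hlt
    exact hcore S hS hblock
  have heq := ae_eq_of_average_le (h3 t₁ ω).1 (h3 t₁ ω).2 (h4 t₁ ht₁ ω)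
    (hfa.integrable ω).integrableOn (fun t => hfa.mem t ω) hle
  filter_upwards [(ae_restrict_iff' hT₁).1 heq] with t ht
  by_cases htT : t ∈ E.T₁
  · have hEq := (h6 t htT t₁ ht₁).2.1 ω
    rw [Economy.average, if_pos htT, ← setAverage_eq, hEq hb, hEq (hfa.mem t ω), ht htT]
  · rw [Economy.average, if_neg htT]
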